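/- A \emph{complete binary tree} is a finite ordered rooted tree in which every vertex has either $0$ or exactly $2$ children. For $n\ge 1$ let $\mathcal T_n$ be the (finite) set of complete binary trees with exactly $n$ vertices, and for $t\in\mathcal T_n$ let $H_n(t)$ be the total height of $t$, i.e. the sum of the distances of all vertices of $t$ to the root. Regard $H_n$ as a random variable on $\mathcal T_n$ with the uniform distribution, and put $$\mu=E[H_n],\qquad m_i(n)=E\big[(H_n-\mu)^i\big],\qquad \alpha_i(n)=\frac{m_i(n)}{m_2(n)^{i/2}} .$$ Then $\mathcal T_n$ is non-empty exactly when $n$ is odd, $m_2(n)>0$ for every odd $n\ge 7$, and, as $n\to\infty$ through the odd integers, the limits $\alpha_i=\lim\alpha_i(n)$ exist for $3\le i\le 9$ and are equal to $$\alpha_3=\frac{\left(6\pi-\frac{75}{4}\right)\sqrt3\,\sqrt{\frac{\pi}{10-3\pi}}}{10-3\pi},\qquad \alpha_4=\frac{-189\pi^2+315\pi+884}{7(10-3\pi)^2},$$ $$\alpha_5=\frac{\left(36\pi^2+\frac{75}{2}\pi-\frac{105845}{224}\right)\sqrt3\,\sqrt{\frac{\pi}{10-3\pi}}}{(10-3\pi)^2},$$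 $$\alpha_6=\frac{15}{16016}\cdot\frac{-144144\pi^3-720720\pi^2+3013725\pi+2120320}{(10-3\pi)^3},$$ $$\alpha_7=\frac{\left(162\pi^3+\frac{6615}{4}\pi^2-\frac{103965}{32}\pi-\frac{101897475}{9152}\right)\sqrt3\,\sqrt{\frac{\pi}{10-3\pi}}}{(10-3\pi)^3},$$ $$\alpha_8=\frac{3}{2586584}\cdot\frac{-488864376\pi^4-8147739600\pi^3-455885430\pi^2+86568885375\pi+32820007040}{(10-3\pi)^4},$$ $$\alpha_9=\frac{\left(648\pi^4+15795\pi^3+\frac{591867}{16}\pi^2-\frac{461286225}{2288}\pi-\frac{188411947088175}{662165504}\right)\sqrt3\,\sqrt{\frac{\pi}{10-3\pi}}}{(10-3\pi)^4}.$$ -/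

import Mathlib

/-- Finite ordered rooted trees: a root together with a list of `k` (possibly `k = 0`) subtrees,
read from left to right. -/
inductive OrderedTree : Type
  | node (k : ℕ) (children : Fin k → OrderedTree) : OrderedTree

namespace OrderedTree

/-- The number of vertices. -/
def numVertices : OrderedTree → ℕ
  | node _ c => 1 + ∑ i, (c i).numVertices

/-- The sum over all vertices `v` of `d + dist(v, root)`: the root is at depth `d`, and each child
is one level deeper than its parent. -/
def depthSum : OrderedTree → ℕ → ℕ
  | node _ c, d => d + ∑ i, (c i).depthSum (d + 1)

/-- The total height `H(t)`: the sum of the distances of all vertices to the root. -/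
def totalHeight (t : OrderedTree) : ℕ := t.depthSum 0

/-- Every vertex has no children or a number of children that belongs to `S`. -/
def DegreesIn (S : Finset ℕ) : OrderedTree → Prop
  | node k c => (k = 0 ∨ k ∈ S) ∧ ∀ i, (c i).DegreesIn S

theorem finite_numVertices_le (n : ℕ) : {t : OrderedTree | t.numVertices ≤ n}.Finite := by
  induction n with
  | zero =>
    refine Set.Finite.subset Set.finite_empty ?_
    rintro ⟨k, c⟩ h
    simp [numVertices] at h
  | succ n ih =>
    refine Set.Finite.subset
      (Set.Finite.biUnion (Set.finite_Iic n) (fun k _ =>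
        Set.Finite.image (node k)
          (Set.Finite.pi' (fun _ : Fin k => ih)))) ?_
    rintro ⟨k, c⟩ h
    have hpos : ∀ t : OrderedTree, 1 ≤ t.numVertices := by
      rintro ⟨k, c⟩
      simp [numVertices]
    have h1 : ∑ i, (c i).numVertices ≤ n := by
      simp only [Set.mem_ofPred_eq, numVertices] at h
      omega
    have h2 : k ≤ n := by
      have := Finset.sum_le_sum (fun (i : Fin k) (_ : i ∈ Finset.univ) => hpos (c i))
      simp at this
      omega
    simp only [Set.mem_iUnion, Set.mem_image]
    refine ⟨k, h2, c, fun i => ?_, rfl⟩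
    exact (Finset.single_le_sum (f := fun i => (c i).numVertices)
      (fun _ _ => Nat.zero_le _) (Finset.mem_univ i)).trans h1

theorem finite_family (S : Finset ℕ) (n : ℕ) :
    {t : OrderedTree | t.DegreesIn S ∧ t.numVertices = n}.Finite :=
  (finite_numVertices_le n).subset fun _ h => h.2.le

/-- The set `T_n(S)` of all ordered rooted trees with exactly `n` vertices in which every vertex
is a leaf or has a number of children that belongs to `S`. -/
noncomputable def family (S : Finset ℕ) (n : ℕ) : Finset OrderedTree :=
  (finite_family S n).toFinset

end OrderedTree

/-- The expectation of the random variable `X` on the finite set `A` with the uniform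
distribution. -/
noncomputable def uniformMean {α : Type*} (A : Finset α) (X : α → ℝ) : ℝ :=
  (∑ a ∈ A, X a) / (A.card : ℝ)

/-- The `i`-th moment about the mean, `m_i = E[(X - μ)^i]`. -/
noncomputable def centralMomentOn {α : Type*} (A : Finset α) (X : α → ℝ) (i : ℕ) : ℝ :=
  uniformMean A (fun a => (X a - uniformMean A X) ^ i)

/-- The `i`-th scaled moment (alpha coefficient), `α_i = m_i / m_2 ^ (i / 2)`. -/
noncomputable def scaledMomentOn {α : Type*} (A : Finset α) (X : α → ℝ) (i : ℕ) : ℝ :=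
  centralMomentOn A X i / (centralMomentOn A X 2) ^ ((i : ℝ) / 2)

/-- The variance of the total height on complete binary trees (`S = {2}`) with `n` vertices. -/
noncomputable def binaryHeightVariance (n : ℕ) : ℝ :=
  centralMomentOn (OrderedTree.family {2} n) (fun t => (t.totalHeight : ℝ)) 2

/-- The `i`-th scaled moment of the total height on complete binary trees (`S = {2}`) with `n`
vertices. -/
noncomputable def binaryHeightScaledMoment (i n : ℕ) : ℝ :=
  scaledMomentOn (OrderedTree.family {2} n) (fun t => (t.totalHeight : ℝ)) i

open Real Filter Topology

/-! A complete binary tree is determined by its internal vertices, which form an arbitrary binary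
tree `t`. Its total height counts pairs (vertex, proper descendant); an internal vertex whose
subtree has `p` internal vertices has `2 * p` proper descendants, so the total height is `2 *
sizeSum t`. Scaled moments ignore the factor, and the problem becomes that of the moments of
`sizeSum`.

Let `F k` be the generating series of `sizeSum ^ k`, with `X` marking leaves. Splitting at the root
gives `F 0 = X + F 0 ^ 2` and expresses `F (k + 1)` through products of the `F b` and the operator
`X d/dX - 1`, which multiplies by the number of nodes (`sizeSumSeries_succ_eq`). With `u = (1 - 4 X)
^ (-1/2)` one has `1 - 2 * F 0 = u⁻¹`, and `X d/dX` sends `u ^ j` to `(j / 2) (u ^ (j + 2) - u ^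
j)`. Hence each `F (k + 1)` is a finite combination of integer powers of `u`, with leading term
`leadingConst k * u ^ (3 * k + 2)` given by a quadratic recursion (`hasLeading_sizeSumSeries_succ`).

The `n`-th coefficient of `u ^ j` is asymptotic to `4 ^ n * n ^ (j / 2 - 1) / Γ (j / 2)`, read as a
limit `0` of the quotient at the poles of `Γ` (`tendsto_scaledCoeff_zpow`). Dividing the
coefficients of `F k` by those of `F 0` shows that all moments of `sizeSum / n ^ (3/2)` converge
(`tendsto_moment`). Central moments are polynomials in the moments, and the limit variance `(10 - 3
π) / 3` is positive, so the scaled moments converge too; the rest is arithmetic. -/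

namespace BinaryTree

/-! ### Complete binary trees as binary trees of internal vertices -/

/-- The complete binary tree whose internal vertices are the nodes of `t`. -/
def toOrderedTree : BinaryTree Unit → OrderedTree
  | nil => .node 0 Fin.elim0
  | node _ l r => .node 2 ![l.toOrderedTree, r.toOrderedTree]

/-- The sum of the numbers of nodes of all subtrees of `t`. -/
def sizeSum : BinaryTree Unit → ℕ
  | nil => 0
  | node _ l r => (l.numNodes + r.numNodes + 1) + (l.sizeSum + r.sizeSum)

theorem numVertices_toOrderedTree (t : BinaryTree Unit) :
    t.toOrderedTree.numVertices = 2 * t.numNodes + 1 := by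
  induction t with
  | nil => simp [toOrderedTree, OrderedTree.numVertices]
  | node _ l r hl hr =>
    simp [toOrderedTree, OrderedTree.numVertices, hl, hr, numNodes]
    ring

/-- A general starting depth is needed for the induction: it adds `d` for each of the `2 *
t.numNodes + 1` vertices. -/
theorem depthSum_toOrderedTree (t : BinaryTree Unit) (d : ℕ) :
    t.toOrderedTree.depthSum d = 2 * t.sizeSum + d * (2 * t.numNodes + 1) := by
  induction t generalizing d with
  | nil => simp [toOrderedTree, OrderedTree.depthSum, sizeSum]
  | node _ l r hl hr =>
    simp [toOrderedTree, OrderedTree.depthSum, hl, hr, numNodes, sizeSum]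
    ring

theorem totalHeight_toOrderedTree (t : BinaryTree Unit) :
    t.toOrderedTree.totalHeight = 2 * t.sizeSum := by
  simp [OrderedTree.totalHeight, depthSum_toOrderedTree]

theorem degreesIn_toOrderedTree (t : BinaryTree Unit) : t.toOrderedTree.DegreesIn {2} := by
  induction t with
  | nil => exact ⟨Or.inl rfl, fun i => i.elim0⟩
  | node _ l r hl hr =>
    refine ⟨Or.inr (by simp), fun i => ?_⟩
    fin_cases i
    · exact hl
    · exact hr

theorem toOrderedTree_injective : Function.Injective toOrderedTree := by
  intro s
  induction s with
  | nil =>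
    rintro (_ | _) h
    · rfl
    · simp [toOrderedTree] at h
  | node _ l r hl hr =>
    rintro (_ | ⟨_, l', r'⟩) h
    · simp [toOrderedTree] at h
    · simp only [toOrderedTree, OrderedTree.node.injEq, heq_eq_eq, true_and] at h
      have h0 := congrFun h 0
      have h1 := congrFun h 1
      simp at h0 h1
      rw [hl h0, hr h1]

theorem exists_toOrderedTree_eq (t : OrderedTree) (ht : t.DegreesIn {2}) :
    ∃ s : BinaryTree Unit, s.toOrderedTree = t := by
  induction t with
  | node k c ih =>
    obtain ⟨hk, hc⟩ := ht
    rcases hk with rfl | hk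
    · exact ⟨nil, by simp only [toOrderedTree]; congr 1; ext i; exact i.elim0⟩
    · obtain rfl : k = 2 := by simpa using hk
      obtain ⟨l, hl⟩ := ih 0 (hc 0)
      obtain ⟨r, hr⟩ := ih 1 (hc 1)
      refine ⟨node () l r, ?_⟩
      simp only [toOrderedTree, hl, hr]
      congr 1
      funext i
      fin_cases i <;> rfl

theorem family_eq_map (m : ℕ) :
    OrderedTree.family {2} (2 * m + 1) =
      (treesOfNumNodesEq m).map ⟨toOrderedTree, toOrderedTree_injective⟩ := by
  ext t
  simp only [OrderedTree.family, Set.Finite.mem_toFinset, Set.mem_ofPred_eq, Finset.mem_map,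
    mem_treesOfNumNodesEq, Function.Embedding.coeFn_mk]
  constructor
  · rintro ⟨h, hn⟩
    obtain ⟨s, rfl⟩ := exists_toOrderedTree_eq t h
    rw [numVertices_toOrderedTree] at hn
    exact ⟨s, by omega, rfl⟩
  · rintro ⟨s, rfl, rfl⟩
    exact ⟨degreesIn_toOrderedTree s, numVertices_toOrderedTree s⟩

/-- The tree with `m` nodes in which every left subtree is empty. -/
def rightComb : ℕ → BinaryTree Unit
  | 0 => nil
  | m + 1 => node () nil (rightComb m)

theorem numNodes_rightComb (m : ℕ) : (rightComb m).numNodes = m := by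
  induction m with
  | zero => rfl
  | succ m ih => simp [rightComb, numNodes, ih]

theorem treesOfNumNodesEq_nonempty (m : ℕ) : (treesOfNumNodesEq m).Nonempty :=
  ⟨rightComb m, mem_treesOfNumNodesEq.2 (numNodes_rightComb m)⟩

theorem family_nonempty_iff (n : ℕ) : (OrderedTree.family {2} n).Nonempty ↔ Odd n := by
  constructor
  · rintro ⟨t, ht⟩
    simp only [OrderedTree.family, Set.Finite.mem_toFinset, Set.mem_ofPred_eq] at ht
    obtain ⟨s, rfl⟩ := exists_toOrderedTree_eq t ht.1
    exact ⟨s.numNodes, by rw [← ht.2, numVertices_toOrderedTree]⟩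
  · rintro ⟨m, rfl⟩
    rw [family_eq_map]
    exact (treesOfNumNodesEq_nonempty m).map

theorem exists_sizeSum_ne {m : ℕ} (hm : 3 ≤ m) :
    ∃ s ∈ treesOfNumNodesEq m, ∃ t ∈ treesOfNumNodesEq m, s.sizeSum ≠ t.sizeSum := by
  obtain ⟨m, rfl⟩ := Nat.exists_eq_add_of_le' hm
  -- The two trees share the subtree `rightComb (m + 1)` and the root size; the remaining node has
  -- subtree size `m + 2` in one and `1` in the other.
  refine ⟨node () nil (node () nil (rightComb (m + 1))), ?_,
    node () (node () nil nil) (rightComb (m + 1)), ?_, ?_⟩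
  · simp [mem_treesOfNumNodesEq, numNodes, numNodes_rightComb]
  · simp [mem_treesOfNumNodesEq, numNodes, numNodes_rightComb]
    omega
  · simp [sizeSum, numNodes, numNodes_rightComb]
    omega

theorem sum_treesOfNumNodesEq_succ {M : Type*} [AddCommMonoid M] (m : ℕ)
    (f : BinaryTree Unit → M) :
    ∑ t ∈ treesOfNumNodesEq (m + 1), f t = ∑ p ∈ Finset.HasAntidiagonal.antidiagonal m,
      ∑ l ∈ treesOfNumNodesEq p.1, ∑ r ∈ treesOfNumNodesEq p.2, f (node () l r) := by
  rw [treesOfNumNodesEq_succ, Finset.sum_biUnion]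
  · refine Finset.sum_congr rfl fun p _ => ?_
    rw [pairwiseNode, Finset.sum_map, Finset.sum_product]
    rfl
  · intro p _ q _ hpq
    rw [Function.onFun, Finset.disjoint_left]
    intro t h1 h2
    simp only [pairwiseNode, Finset.mem_map, Finset.mem_product, mem_treesOfNumNodesEq] at h1 h2
    obtain ⟨⟨a, b⟩, ⟨ha, hb⟩, rfl⟩ := h1
    obtain ⟨⟨c, d⟩, ⟨hc, hd⟩, h⟩ := h2
    simp at h
    obtain ⟨rfl, rfl⟩ := h
    exact hpq (Prod.ext (ha.symm.trans hc) (hb.symm.trans hd))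

end BinaryTree

/-! ### Moments under reindexing and scaling -/

theorem uniformMean_map {α β : Type*} (A : Finset α) (e : α ↪ β) (X : β → ℝ) :
    uniformMean (A.map e) X = uniformMean A (fun a => X (e a)) := by
  simp [uniformMean]

theorem centralMomentOn_map {α β : Type*} (A : Finset α) (e : α ↪ β) (X : β → ℝ) (i : ℕ) :
    centralMomentOn (A.map e) X i = centralMomentOn A (fun a => X (e a)) i := by
  simp [centralMomentOn, uniformMean_map]

theorem uniformMean_const_mul {α : Type*} (A : Finset α) (X : α → ℝ) (c : ℝ) :
    uniformMean A (fun a => c * X a) = c * uniformMean A X := by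
  simp [uniformMean, ← Finset.mul_sum, mul_div_assoc]

theorem centralMomentOn_const_mul {α : Type*} (A : Finset α) (X : α → ℝ) (c : ℝ) (i : ℕ) :
    centralMomentOn A (fun a => c * X a) i = c ^ i * centralMomentOn A X i := by
  simp only [centralMomentOn, uniformMean_const_mul, ← mul_sub, mul_pow]

theorem centralMomentOn_two_nonneg {α : Type*} (A : Finset α) (X : α → ℝ) :
    0 ≤ centralMomentOn A X 2 :=
  div_nonneg (Finset.sum_nonneg fun _ _ => sq_nonneg _) (Nat.cast_nonneg _)

theorem centralMomentOn_two_pos {α : Type*} {A : Finset α} {X : α → ℝ} {a b : α} (ha : a ∈ A)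
    (hb : b ∈ A) (hab : X a ≠ X b) : 0 < centralMomentOn A X 2 := by
  refine div_pos ?_ (Nat.cast_pos.2 (Finset.card_pos.2 ⟨a, ha⟩))
  by_contra h
  have h0 := (Finset.sum_eq_zero_iff_of_nonneg fun x _ => sq_nonneg (X x - uniformMean A X)).1
    (le_antisymm (not_lt.1 h) (Finset.sum_nonneg fun _ _ => sq_nonneg _))
  have h1 := pow_eq_zero_iff (two_ne_zero) |>.1 (h0 a ha)
  have h2 := pow_eq_zero_iff (two_ne_zero) |>.1 (h0 b hb)
  exact hab (by linarith)

theorem scaledMomentOn_const_mul {α : Type*} (A : Finset α) (X : α → ℝ) {c : ℝ} (hc : 0 < c)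
    (i : ℕ) : scaledMomentOn A (fun a => c * X a) i = scaledMomentOn A X i := by
  have h : (c ^ 2) ^ ((i : ℝ) / 2) = c ^ i := by
    rw [← Real.rpow_natCast c 2, ← Real.rpow_mul hc.le, ← Real.rpow_natCast c i]
    congr 1
    push_cast
    ring
  rw [scaledMomentOn, scaledMomentOn, centralMomentOn_const_mul, centralMomentOn_const_mul,
    Real.mul_rpow (by positivity) (centralMomentOn_two_nonneg A X), h,
    mul_div_mul_left _ _ (by positivity)]

theorem centralMomentOn_eq_sum {α : Type*} (A : Finset α) (X : α → ℝ) (i : ℕ) :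
    centralMomentOn A X i = ∑ k ∈ Finset.range (i + 1),
      uniformMean A (fun a => X a ^ k) * (-uniformMean A X) ^ (i - k) * (i.choose k : ℝ) := by
  rw [centralMomentOn, uniformMean]
  simp only [sub_eq_add_neg, add_pow]
  rw [Finset.sum_comm, Finset.sum_div]
  refine Finset.sum_congr rfl fun k _ => ?_
  rw [← Finset.sum_mul, ← Finset.sum_mul, mul_assoc, mul_assoc, mul_div_right_comm]
  rfl

open BinaryTree

theorem binaryHeightVariance_pos {m : ℕ} (hm : 3 ≤ m) : 0 < binaryHeightVariance (2 * m + 1) := by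
  obtain ⟨s, hs, t, ht, h⟩ := exists_sizeSum_ne hm
  rw [binaryHeightVariance, family_eq_map, centralMomentOn_map]
  refine centralMomentOn_two_pos hs ht ?_
  simpa [totalHeight_toOrderedTree] using h

/-- The free factor `c` may depend on `m`; it will be the normalisation by the power `-3/2` of the
number of leaves. -/
theorem binaryHeightScaledMoment_eq (i m : ℕ) {c : ℝ} (hc : 0 < c) :
    binaryHeightScaledMoment i (2 * m + 1) =
      scaledMomentOn (treesOfNumNodesEq m) (fun t => c * t.sizeSum) i := by
  have h : binaryHeightScaledMoment i (2 * m + 1) =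
      scaledMomentOn (treesOfNumNodesEq m) (fun t => 2 * (t.sizeSum : ℝ)) i := by
    simp [binaryHeightScaledMoment, scaledMomentOn, family_eq_map, centralMomentOn_map,
      totalHeight_toOrderedTree]
  rw [h, scaledMomentOn_const_mul _ _ two_pos, scaledMomentOn_const_mul _ _ hc]

/-! ### Generating series and the recursion at the root -/

open PowerSeries BinaryTree in
/-- The generating series, by number of leaves, of the `k`-th power of `sizeSum`. -/
noncomputable def sizeSumSeries (k : ℕ) : PowerSeries ℝ :=
  X * mk fun m => ∑ t ∈ treesOfNumNodesEq m, (t.sizeSum : ℝ) ^ k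

namespace PowerSeries

/-- The derivation `X d/dX`. -/
noncomputable def euler : Derivation ℝ ℝ⟦X⟧ ℝ⟦X⟧ := (X : ℝ⟦X⟧) • derivative ℝ

theorem coeff_euler (f : ℝ⟦X⟧) (n : ℕ) : coeff n (euler f) = n * coeff n f := by
  cases n with
  | zero => simp [euler]
  | succ n => simp [euler, coeff_succ_X_mul, coeff_derivative, mul_comm]

/-- The operator `X d/dX - 1`. -/
noncomputable def eulerSubOne : ℝ⟦X⟧ →ₗ[ℝ] ℝ⟦X⟧ := euler.toLinearMap - LinearMap.id

theorem eulerSubOne_apply (f : ℝ⟦X⟧) : eulerSubOne f = euler f - f := rfl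

theorem coeff_eulerSubOne_pow (f : ℝ⟦X⟧) (a n : ℕ) :
    coeff n ((eulerSubOne ^ a) f) = ((n : ℝ) - 1) ^ a * coeff n f := by
  induction a with
  | zero => simp
  | succ a ih =>
    rw [pow_succ', Module.End.mul_apply, eulerSubOne_apply, map_sub, coeff_euler, ih]
    ring

end PowerSeries

open PowerSeries BinaryTree

theorem coeff_succ_sizeSumSeries (k m : ℕ) :
    coeff (m + 1) (sizeSumSeries k) = ∑ t ∈ treesOfNumNodesEq m, (t.sizeSum : ℝ) ^ k := by
  simp [sizeSumSeries, coeff_succ_X_mul]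

/-- The generating series, by number of leaves, of the `k`-th power of the sum of `sizeSum` over
the two subtrees of the root. -/
noncomputable def subtreeSizeSumSeries (k : ℕ) : ℝ⟦X⟧ :=
  ∑ b ∈ Finset.range (k + 1),
    (k.choose b : ℝ) • (sizeSumSeries b * sizeSumSeries (k - b))

theorem sizeSumSeries_mul (b c : ℕ) : sizeSumSeries b * sizeSumSeries c =
    X ^ 2 * ((mk fun m => ∑ t ∈ treesOfNumNodesEq m, (t.sizeSum : ℝ) ^ b) *
      mk fun m => ∑ t ∈ treesOfNumNodesEq m, (t.sizeSum : ℝ) ^ c) := by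
  rw [sizeSumSeries, sizeSumSeries]
  ring

theorem coeff_subtreeSizeSumSeries_of_lt (k : ℕ) {n : ℕ} (hn : n < 2) :
    coeff n (subtreeSizeSumSeries k) = 0 := by
  rw [subtreeSizeSumSeries, map_sum]
  refine Finset.sum_eq_zero fun b _ => ?_
  rw [sizeSumSeries_mul, coeff_smul, coeff_X_pow_mul', if_neg (by omega), smul_zero]

theorem coeff_subtreeSizeSumSeries (k m : ℕ) :
    coeff (m + 2) (subtreeSizeSumSeries k) = ∑ p ∈ Finset.HasAntidiagonal.antidiagonal m,
      ∑ l ∈ treesOfNumNodesEq p.1, ∑ r ∈ treesOfNumNodesEq p.2,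
        ((l.sizeSum : ℝ) + r.sizeSum) ^ k := by
  simp only [subtreeSizeSumSeries, map_sum, sizeSumSeries_mul, coeff_smul, coeff_X_pow_mul]
  simp only [coeff_mul, coeff_mk, add_pow, Finset.smul_sum]
  rw [Finset.sum_comm]
  refine Finset.sum_congr rfl fun p _ => ?_
  simp only [Finset.sum_mul_sum, Finset.smul_sum]
  rw [Finset.sum_comm]
  refine Finset.sum_congr rfl fun l _ => ?_
  rw [Finset.sum_comm]
  refine Finset.sum_congr rfl fun r _ => Finset.sum_congr rfl fun b _ => ?_
  rw [smul_eq_mul]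
  ring

/-- At a root with subtrees `l` and `r`, `sizeSum` is the number of nodes plus `l.sizeSum +
r.sizeSum`; expand the power binomially. A tree has one node fewer than leaves, whence `X d/dX - 1`.
-/
theorem sizeSumSeries_succ_eq (k : ℕ) : sizeSumSeries (k + 1) =
    ∑ a ∈ Finset.range (k + 2),
      ((k + 1).choose a : ℝ) • (eulerSubOne ^ a) (subtreeSizeSumSeries (k + 1 - a)) := by
  ext n
  rw [map_sum]
  simp only [coeff_smul, coeff_eulerSubOne_pow]
  rcases n with _ | _ | n
  · simp [coeff_subtreeSizeSumSeries_of_lt, sizeSumSeries]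
  -- The empty tree contributes `0 ^ (k + 1) = 0`; for exponent `0` it contributes the term `X` of
  -- `sizeSumSeries_zero_eq`.
  · simp [coeff_subtreeSizeSumSeries_of_lt, coeff_succ_sizeSumSeries, treesOfNumNodesEq_zero,
      sizeSum]
  · rw [coeff_succ_sizeSumSeries, sum_treesOfNumNodesEq_succ]
    simp only [coeff_subtreeSizeSumSeries, Finset.mul_sum, Finset.smul_sum]
    refine Eq.trans ?_ Finset.sum_comm
    refine Finset.sum_congr rfl fun p hp => ?_
    refine Eq.trans ?_ Finset.sum_comm
    refine Finset.sum_congr rfl fun l hl => ?_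
    refine Eq.trans ?_ Finset.sum_comm
    refine Finset.sum_congr rfl fun r hr => ?_
    rw [mem_treesOfNumNodesEq] at hl hr
    have hn : l.numNodes + r.numNodes = n := by
      rw [hl, hr]
      exact Finset.HasAntidiagonal.mem_antidiagonal.1 hp
    rw [sizeSum, ← hn]
    push_cast
    rw [add_pow]
    refine Finset.sum_congr rfl fun a _ => ?_
    rw [smul_eq_mul]
    ring

theorem sizeSumSeries_zero_eq : sizeSumSeries 0 = X + sizeSumSeries 0 ^ 2 := by
  have h : sizeSumSeries 0 ^ 2 = subtreeSizeSumSeries 0 := by simp [subtreeSizeSumSeries, sq]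
  rw [h]
  ext n
  rcases n with _ | _ | n
  · rw [map_add, coeff_subtreeSizeSumSeries_of_lt 0 (by omega)]
    simp [sizeSumSeries]
  · simp [coeff_subtreeSizeSumSeries_of_lt, coeff_succ_sizeSumSeries, treesOfNumNodesEq_zero]
  · rw [coeff_succ_sizeSumSeries, sum_treesOfNumNodesEq_succ, map_add,
      coeff_subtreeSizeSumSeries]
    simp [coeff_X]

theorem isUnit_one_sub_two_mul_sizeSumSeries : IsUnit (1 - 2 * sizeSumSeries 0) := by
  rw [isUnit_iff_constantCoeff]
  simp [sizeSumSeries]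

/-! ### The series `rsqrt` and its integer powers -/

namespace PowerSeries

/-- The power series `(1 - 4 X) ^ (-1 / 2)`. -/
noncomputable def rsqrt : ℝ⟦X⟧ˣ := isUnit_one_sub_two_mul_sizeSumSeries.unit⁻¹

theorem rsqrt_inv : ((rsqrt⁻¹ : ℝ⟦X⟧ˣ) : ℝ⟦X⟧) = 1 - 2 * sizeSumSeries 0 := by
  simp [rsqrt]

theorem rsqrt_inv_sq : ((rsqrt⁻¹ : ℝ⟦X⟧ˣ) : ℝ⟦X⟧) ^ 2 = 1 - 4 * X := by
  rw [rsqrt_inv]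
  linear_combination -4 * sizeSumSeries_zero_eq

theorem euler_rsqrt_inv : euler ((rsqrt⁻¹ : ℝ⟦X⟧ˣ) : ℝ⟦X⟧) =
    -- Apply `X d/dX` to `s ^ 2 = 1 - 4 X`: this gives `2 s (euler s) = -4 X = s ^ 2 - 1`. Then
    -- multiply by `rsqrt / 2`.
    (1 / 2 : ℝ) • (((rsqrt⁻¹ : ℝ⟦X⟧ˣ) : ℝ⟦X⟧) - (rsqrt : ℝ⟦X⟧)) := by
  set s : ℝ⟦X⟧ := ((rsqrt⁻¹ : ℝ⟦X⟧ˣ) : ℝ⟦X⟧) with hs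
  have h1 : (2 : ℝ) • (s * euler s) = s ^ 2 - 1 := by
    have h := congrArg euler rsqrt_inv_sq
    have h4 : (4 : ℝ⟦X⟧) * X = (4 : ℝ) • X := by
      rw [smul_eq_C_mul, map_ofNat]
    have hX : euler X = (X : ℝ⟦X⟧) := by simp [euler]
    rw [← hs, sq, Derivation.leibniz, h4, map_sub, Derivation.map_smul, hX,
      Derivation.map_one_eq_zero, ← h4] at h
    rw [two_smul]
    rw [smul_eq_mul] at h
    linear_combination h - rsqrt_inv_sq
  have h2 : (rsqrt : ℝ⟦X⟧) * s = 1 := Units.mul_inv rsqrt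
  have h3 := congrArg (fun f => (1 / 2 : ℝ) • ((rsqrt : ℝ⟦X⟧) * f)) h1
  simp only [mul_smul_comm, smul_smul, ← mul_assoc, h2] at h3
  norm_num at h3
  rw [h3]
  norm_num
  linear_combination s * h2

theorem euler_rsqrt_zpow (j : ℤ) : euler ((rsqrt ^ j : ℝ⟦X⟧ˣ) : ℝ⟦X⟧) =
    ((j : ℝ) / 2) • (((rsqrt ^ (j + 2) : ℝ⟦X⟧ˣ) : ℝ⟦X⟧) - ((rsqrt ^ j : ℝ⟦X⟧ˣ) : ℝ⟦X⟧)) := by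
  have hmul : (rsqrt : ℝ⟦X⟧) * ((rsqrt⁻¹ : ℝ⟦X⟧ˣ) : ℝ⟦X⟧) = 1 := Units.mul_inv rsqrt
  have hinv := euler_rsqrt_inv
  have hu : euler (rsqrt : ℝ⟦X⟧) = (1 / 2 : ℝ) • ((rsqrt : ℝ⟦X⟧) ^ 3 - (rsqrt : ℝ⟦X⟧)) := by
    have h := congrArg euler hmul
    rw [Derivation.leibniz, hinv, Derivation.map_one_eq_zero, smul_eq_mul, smul_eq_mul] at h
    simp only [smul_eq_C_mul] at h ⊢
    linear_combination (rsqrt : ℝ⟦X⟧) * h - (euler (rsqrt : ℝ⟦X⟧) + C (1 / 2 : ℝ) * rsqrt) * hmul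
  induction j with
  | zero => simp
  | succ j ih =>
    rw [zpow_add_one, Units.val_mul, Derivation.leibniz, hu, ih, smul_eq_mul, smul_eq_mul,
      add_right_comm, zpow_add_one, zpow_add _ _ 2, Units.val_mul, Units.val_mul]
    simp only [smul_eq_C_mul]
    push_cast
    rw [add_div, map_add]
    norm_cast
    push_cast
    ring
  | pred j ih =>
    rw [zpow_sub_one, Units.val_mul, Derivation.leibniz, hinv, ih, smul_eq_mul, smul_eq_mul,
      show -(j : ℤ) - 1 + 2 = -(j : ℤ) + 1 by ring, zpow_add_one, zpow_add _ _ 2, Units.val_mul,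
      Units.val_mul, show (2 : ℤ) = (2 : ℕ) from rfl, zpow_natCast, Units.val_pow_eq_pow_val]
    simp only [smul_eq_C_mul]
    push_cast
    rw [sub_div, map_sub]
    linear_combination (C (-(j : ℝ) / 2) * (rsqrt : ℝ⟦X⟧) * ((rsqrt ^ (-(j : ℤ)) : ℝ⟦X⟧ˣ) : ℝ⟦X⟧)) * hmul

end PowerSeries

/-! ### Filtration by powers of `rsqrt` and leading terms -/

namespace PowerSeries

/-- The span of the powers of `rsqrt` with exponent at most `a`. -/
noncomputable def rsqrtSpan (a : ℤ) : Submodule ℝ ℝ⟦X⟧ :=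
  Submodule.span ℝ {f | ∃ j ≤ a, ((rsqrt ^ j : ℝ⟦X⟧ˣ) : ℝ⟦X⟧) = f}

theorem zpow_mem_rsqrtSpan {a j : ℤ} (h : j ≤ a) :
    ((rsqrt ^ j : ℝ⟦X⟧ˣ) : ℝ⟦X⟧) ∈ rsqrtSpan a :=
  Submodule.subset_span ⟨j, h, rfl⟩

theorem rsqrtSpan_mono {a b : ℤ} (h : a ≤ b) : rsqrtSpan a ≤ rsqrtSpan b :=
  Submodule.span_mono fun _ ⟨j, hj, hf⟩ => ⟨j, hj.trans h, hf⟩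

theorem mul_mem_rsqrtSpan {a b c : ℤ} {f g : ℝ⟦X⟧} (hf : f ∈ rsqrtSpan a) (hg : g ∈ rsqrtSpan b)
    (hc : a + b ≤ c) : f * g ∈ rsqrtSpan c := by
  refine rsqrtSpan_mono hc ?_
  have h := Submodule.mul_mem_mul hf hg
  rw [rsqrtSpan, rsqrtSpan, Submodule.span_mul_span] at h
  refine Submodule.span_mono ?_ h
  rintro _ ⟨_, ⟨i, hi, rfl⟩, _, ⟨j, hj, rfl⟩, rfl⟩
  exact ⟨i + j, add_le_add hi hj, by simp [zpow_add]⟩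

theorem eulerSubOne_zpow_sub_mem (j : ℤ) :
    eulerSubOne ((rsqrt ^ j : ℝ⟦X⟧ˣ) : ℝ⟦X⟧) -
      ((j : ℝ) / 2) • ((rsqrt ^ (j + 2) : ℝ⟦X⟧ˣ) : ℝ⟦X⟧) ∈ rsqrtSpan j := by
  have h := zpow_mem_rsqrtSpan (le_refl j)
  rw [eulerSubOne_apply, euler_rsqrt_zpow, smul_sub, sub_right_comm, sub_sub_cancel_left]
  exact sub_mem (neg_mem (Submodule.smul_mem _ _ h)) h

theorem eulerSubOne_mem {a b : ℤ} {f : ℝ⟦X⟧} (hf : f ∈ rsqrtSpan a) (h : a + 2 ≤ b) :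
    eulerSubOne f ∈ rsqrtSpan b := by
  refine rsqrtSpan_mono h ?_
  rw [rsqrtSpan] at hf
  induction hf using Submodule.span_induction with
  | mem f hf =>
    obtain ⟨j, hj, rfl⟩ := hf
    have h1 := rsqrtSpan_mono (show j ≤ a + 2 by omega) (eulerSubOne_zpow_sub_mem j)
    have h2 := Submodule.smul_mem _ ((j : ℝ) / 2)
      (zpow_mem_rsqrtSpan (show j + 2 ≤ a + 2 by omega))
    simpa using add_mem h1 h2
  | zero => simp
  | add f g _ _ hf hg => rw [map_add]; exact add_mem hf hg
  | smul c f _ hf => rw [map_smul]; exact Submodule.smul_mem _ _ hf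

theorem eulerSubOne_pow_mem {a b : ℤ} {f : ℝ⟦X⟧} (hf : f ∈ rsqrtSpan a) (n : ℕ)
    (h : a + 2 * n ≤ b) : (eulerSubOne ^ n) f ∈ rsqrtSpan b := by
  refine rsqrtSpan_mono h ?_
  clear h
  induction n with
  | zero => simpa using hf
  | succ n ih =>
    rw [pow_succ', Module.End.mul_apply]
    exact eulerSubOne_mem ih (by push_cast; omega)

/-- The series `f` agrees with `c * rsqrt ^ d` up to lower powers of `rsqrt`. -/
def HasLeading (f : ℝ⟦X⟧) (c : ℝ) (d : ℤ) : Prop :=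
  f - c • ((rsqrt ^ d : ℝ⟦X⟧ˣ) : ℝ⟦X⟧) ∈ rsqrtSpan (d - 1)

namespace HasLeading

variable {f g : ℝ⟦X⟧} {c c' : ℝ} {d d' : ℤ}

theorem mem (h : HasLeading f c d) : f ∈ rsqrtSpan d := by
  have h1 := rsqrtSpan_mono (show d - 1 ≤ d by omega) h
  simpa using add_mem h1 (Submodule.smul_mem _ c (zpow_mem_rsqrtSpan (le_refl d)))

theorem add_mem (h : HasLeading f c d) (hg : g ∈ rsqrtSpan (d - 1)) : HasLeading (f + g) c d := by
  rw [HasLeading, add_sub_right_comm]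
  exact Submodule.add_mem _ h hg

theorem add (h : HasLeading f c d) (hg : HasLeading g c' d) : HasLeading (f + g) (c + c') d := by
  rw [HasLeading, add_smul, add_sub_add_comm]
  exact Submodule.add_mem _ h hg

theorem smul (h : HasLeading f c d) (r : ℝ) : HasLeading (r • f) (r * c) d := by
  rw [HasLeading, mul_smul, ← smul_sub]
  exact Submodule.smul_mem _ r h

theorem sum {ι : Type*} {s : Finset ι} {f : ι → ℝ⟦X⟧} {c : ι → ℝ}
    (h : ∀ i ∈ s, HasLeading (f i) (c i) d) : HasLeading (∑ i ∈ s, f i) (∑ i ∈ s, c i) d := by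
  rw [HasLeading, Finset.sum_smul, ← Finset.sum_sub_distrib]
  exact Submodule.sum_mem _ h

theorem zpow (d : ℤ) : HasLeading ((rsqrt ^ d : ℝ⟦X⟧ˣ) : ℝ⟦X⟧) 1 d := by
  simp [HasLeading]

theorem mul (h : HasLeading f c d) (hg : HasLeading g c' d') :
    HasLeading (f * g) (c * c') (d + d') := by
  have h1 : f * g - (c * c') • ((rsqrt ^ (d + d') : ℝ⟦X⟧ˣ) : ℝ⟦X⟧) =
      (f - c • ((rsqrt ^ d : ℝ⟦X⟧ˣ) : ℝ⟦X⟧)) * g +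
        (c • ((rsqrt ^ d : ℝ⟦X⟧ˣ) : ℝ⟦X⟧)) * (g - c' • ((rsqrt ^ d' : ℝ⟦X⟧ˣ) : ℝ⟦X⟧)) := by
    rw [zpow_add, Units.val_mul]
    simp only [smul_eq_C_mul, map_mul]
    ring
  rw [HasLeading, h1]
  exact Submodule.add_mem _ (mul_mem_rsqrtSpan h hg.mem (by omega))
    (mul_mem_rsqrtSpan (Submodule.smul_mem _ _ (zpow_mem_rsqrtSpan le_rfl)) hg (by omega))

theorem eulerSubOne (h : HasLeading f c d) :
    HasLeading (eulerSubOne f) (c * (d / 2)) (d + 2) := by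
  have h1 := PowerSeries.eulerSubOne_mem h (show d - 1 + 2 ≤ d + 2 - 1 by omega)
  have h2 := Submodule.smul_mem _ c (rsqrtSpan_mono (show d ≤ d + 2 - 1 by omega)
    (eulerSubOne_zpow_sub_mem d))
  rw [map_sub, map_smul] at h1
  have h3 := Submodule.add_mem _ h1 h2
  rwa [smul_sub, sub_add_sub_cancel, smul_smul] at h3

theorem cast (h : HasLeading f c d) (hc : c = c') (hd : d = d') : HasLeading f c' d' := by
  subst hc hd
  exact h

end HasLeading

end PowerSeries

/-! ### Leading terms of the moment series -/

open PowerSeries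

/-- The coefficient of the leading term of `sizeSumSeries (k + 1)`. -/
noncomputable def leadingConst : ℕ → ℝ
  | 0 => 1 / 4
  | k + 1 => ∑ b : Fin (k + 1),
      ((k + 2).choose (b + 1) : ℝ) * (leadingConst b * leadingConst (k - b)) +
        (k + 2) * ((3 * k + 2) / 2 * leadingConst k)

theorem two_smul_sizeSumSeries_zero :
    (2 : ℝ) • sizeSumSeries 0 = 1 - ((rsqrt ^ (-1 : ℤ) : ℝ⟦X⟧ˣ) : ℝ⟦X⟧) := by
  rw [zpow_neg_one, rsqrt_inv, sub_sub_cancel, smul_eq_C_mul, map_ofNat]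

theorem hasLeading_sizeSumSeries_zero : HasLeading (sizeSumSeries 0) (1 / 2) 0 := by
  have h1 : sizeSumSeries 0 = (1 / 2 : ℝ) • ((2 : ℝ) • sizeSumSeries 0) := by
    rw [smul_smul]; norm_num
  rw [h1, two_smul_sizeSumSeries_zero, sub_eq_add_neg]
  have h2 : HasLeading (1 : ℝ⟦X⟧) 1 0 := by simpa using HasLeading.zpow 0
  exact ((h2.add_mem (neg_mem (zpow_mem_rsqrtSpan (by norm_num)))).smul (1 / 2)).cast
    (by norm_num) rfl

theorem subtreeSizeSumSeries_succ (k : ℕ) : subtreeSizeSumSeries (k + 1) =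
    (2 : ℝ) • sizeSumSeries 0 * sizeSumSeries (k + 1) + ∑ b ∈ Finset.range k,
      ((k + 1).choose (b + 1) : ℝ) • (sizeSumSeries (b + 1) * sizeSumSeries (k - b)) := by
  rw [subtreeSizeSumSeries, Finset.sum_range_succ, Finset.sum_range_succ', two_smul]
  simp only [Nat.choose_zero_right, Nat.choose_self, Nat.cast_one, one_smul, Nat.sub_self,
    Nat.sub_zero, Nat.add_sub_add_right]
  ring

/-- The unknown series also occurs on the right of `sizeSumSeries_succ_eq`, as `2 F 0 * F (k + 1)`.
Moving it to the left leaves the factor `1 - 2 F 0 = rsqrt⁻¹`, and only series of lower index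
remain. -/
theorem sizeSumSeries_succ_mul (k : ℕ) :
    sizeSumSeries (k + 1) * ((rsqrt ^ (-1 : ℤ) : ℝ⟦X⟧ˣ) : ℝ⟦X⟧) =
      (∑ b ∈ Finset.range k,
        ((k + 1).choose (b + 1) : ℝ) • (sizeSumSeries (b + 1) * sizeSumSeries (k - b))) +
      ((k + 1 : ℝ) • eulerSubOne (subtreeSizeSumSeries k) +
      ∑ a ∈ Finset.range k, ((k + 1).choose (a + 2) : ℝ) •
        (eulerSubOne ^ (a + 2)) (subtreeSizeSumSeries (k - (a + 1)))) := by
  have h := sizeSumSeries_succ_eq k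
  rw [Finset.sum_range_succ', Finset.sum_range_succ'] at h
  simp only [Nat.choose_zero_right, Nat.cast_one, one_smul, Nat.sub_zero, pow_zero,
    Module.End.one_apply, zero_add, Nat.choose_one_right, pow_one, Nat.add_sub_add_right,
    subtreeSizeSumSeries_succ k, two_smul_sizeSumSeries_zero] at h
  push_cast at h
  linear_combination h

/-- Applying `X d/dX - 1` to the constant term `1/4` does not raise its degree, so the leading term
comes from `-1/2 * rsqrt⁻¹`, with coefficient `(-1/2) * (-1/2)`. -/
theorem subtreeSizeSumSeries_zero_leading :
    HasLeading (eulerSubOne (subtreeSizeSumSeries 0)) (1 / 4) 1 := by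
  have h : subtreeSizeSumSeries 0 = (1 / 4 : ℝ) • ((rsqrt ^ (0 : ℤ) : ℝ⟦X⟧ˣ) : ℝ⟦X⟧) +
      ((-1 / 2 : ℝ) • ((rsqrt ^ (-1 : ℤ) : ℝ⟦X⟧ˣ) : ℝ⟦X⟧) +
      (1 / 4 : ℝ) • ((rsqrt ^ (-2 : ℤ) : ℝ⟦X⟧ˣ) : ℝ⟦X⟧)) := by
    have h1 : subtreeSizeSumSeries 0 =
        (1 / 4 : ℝ) • (((2 : ℝ) • sizeSumSeries 0) * ((2 : ℝ) • sizeSumSeries 0)) := by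
      rw [smul_mul_smul_comm, smul_smul]
      norm_num [subtreeSizeSumSeries]
    rw [h1, two_smul_sizeSumSeries_zero, show (-2 : ℤ) = -1 + -1 by norm_num, zpow_add,
      Units.val_mul, zpow_zero, Units.val_one]
    set s : ℝ⟦X⟧ := ((rsqrt ^ (-1 : ℤ) : ℝ⟦X⟧ˣ) : ℝ⟦X⟧)
    have h2 : (1 - s) * (1 - s) = 1 + ((-2 : ℝ) • s + s * s) := by
      rw [neg_smul, two_smul]; ring
    rw [h2, smul_add, smul_add, smul_smul]
    norm_num
  have h0 : eulerSubOne ((rsqrt ^ (0 : ℤ) : ℝ⟦X⟧ˣ) : ℝ⟦X⟧) ∈ rsqrtSpan (1 - 1) := by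
    simpa using eulerSubOne_zpow_sub_mem 0
  rw [h, map_add, map_smul, add_comm, map_add]
  refine HasLeading.add_mem (HasLeading.add_mem ?_ ?_) (Submodule.smul_mem _ _ h0)
  · exact ((HasLeading.zpow (-1)).smul (-1 / 2)).eulerSubOne.cast (by norm_num) (by norm_num)
  · exact eulerSubOne_mem (Submodule.smul_mem _ _ (zpow_mem_rsqrtSpan le_rfl)) (by norm_num)

/-- Since `2 F 0 = 1 - rsqrt⁻¹`, the extreme terms give `F (k + 1)` up to lower order; the other
products have degree `(3 b + 2) + (3 (k - b - 1) + 2) = 3 k + 1`. -/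
theorem hasLeading_subtreeSizeSumSeries {k : ℕ} (h : ∀ j ≤ k,
    HasLeading (sizeSumSeries (j + 1)) (leadingConst j) (3 * j + 2)) :
    HasLeading (subtreeSizeSumSeries (k + 1)) (leadingConst k) (3 * k + 2) := by
  rw [subtreeSizeSumSeries_succ, two_smul_sizeSumSeries_zero, sub_mul, one_mul, sub_eq_add_neg]
  refine HasLeading.add_mem (HasLeading.add_mem (h k le_rfl) (neg_mem ?_)) ?_
  · exact mul_mem_rsqrtSpan (zpow_mem_rsqrtSpan le_rfl) (h k le_rfl).mem (by omega)
  · refine Submodule.sum_mem _ fun b hb => Submodule.smul_mem _ _ ?_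
    rw [Finset.mem_range] at hb
    have h2 := h (k - (b + 1)) (by omega)
    rw [show k - (b + 1) + 1 = k - b by omega] at h2
    exact mul_mem_rsqrtSpan (h b hb.le).mem h2.mem (by omega)

/-- In `sizeSumSeries_succ_mul` the products and the term with a single `eulerSubOne` have degree `3
k + 1` and yield the recursion of `leadingConst`. Each further `eulerSubOne` raises the degree by 2
but lowers the index of the series, which costs 3. -/
theorem hasLeading_sizeSumSeries_succ (k : ℕ) :
    HasLeading (sizeSumSeries (k + 1)) (leadingConst k) (3 * k + 2) := by
  induction k using Nat.strong_induction_on with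
  | _ k ih =>
  have key : HasLeading (sizeSumSeries (k + 1) * ((rsqrt ^ (-1 : ℤ) : ℝ⟦X⟧ˣ) : ℝ⟦X⟧))
      (leadingConst k) (3 * k + 1) := by
    rw [sizeSumSeries_succ_mul]
    rcases k with _ | k
    · rw [leadingConst]
      simpa using subtreeSizeSumSeries_zero_leading
    · rw [leadingConst]
      refine HasLeading.add ?_ (HasLeading.add_mem ?_ ?_)
      · rw [Finset.sum_range]
        refine HasLeading.sum fun b _ => HasLeading.smul ?_ _
        have h1 := ih b b.2
        have h2 := ih (k - b) (by omega)
        rw [show k - (b : ℕ) + 1 = k + 1 - b by omega] at h2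
        exact (h1.mul h2).cast rfl (by push_cast; omega)
      · have h := ((hasLeading_subtreeSizeSumSeries (k := k) fun j hj => ih j (by omega)).eulerSubOne.smul
          ((k + 1 : ℕ) + 1 : ℝ))
        refine h.cast ?_ (by push_cast; omega)
        push_cast
        ring
      · refine Submodule.sum_mem _ fun a ha => Submodule.smul_mem _ _ ?_
        rw [Finset.mem_range] at ha
        rw [Nat.add_sub_add_right]
        -- Index `0` is special: the bound has to use that the first `eulerSubOne` brings the degree
        -- only from 0 to 1, since a gain of 2 would be too weak for `k = 0`.
        obtain rfl | ha := (Nat.lt_succ_iff.1 ha).eq_or_lt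
        · rw [Nat.sub_self, pow_succ, Module.End.mul_apply]
          exact eulerSubOne_pow_mem subtreeSizeSumSeries_zero_leading.mem _ (by push_cast; omega)
        · have h := (hasLeading_subtreeSizeSumSeries (k := k - (a + 1))
            fun j hj => ih j (by omega)).mem
          rw [show k - (a + 1) + 1 = k - a by omega] at h
          exact eulerSubOne_pow_mem h _ (by push_cast; omega)
  have h := key.mul (HasLeading.zpow 1)
  rw [mul_assoc, ← Units.val_mul, ← zpow_add, neg_add_cancel, zpow_zero, Units.val_one,
    mul_one] at h
  exact h.cast (mul_one _) (by ring)

/-! ### Asymptotics of coefficients -/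

theorem tendsto_centralBinom_div :
    Tendsto (fun n : ℕ => (n.centralBinom : ℝ) / (4 ^ n * (n : ℝ) ^ (-1 / 2 : ℝ))) atTop
      (𝓝 (√π)⁻¹) := by
  have h := Stirling.tendsto_stirlingSeq_sqrt_pi
  -- The quotient is `stirlingSeq (2 n) / stirlingSeq n ^ 2`, which tends to `√π / π`.
  have h2 := (h.comp (tendsto_id.const_mul_atTop' (zero_lt_two' ℕ))).div (h.pow 2) (by positivity)
  have hpi : √π / √π ^ 2 = (√π)⁻¹ := by
    have : √π ≠ 0 := by positivity
    field_simp
  rw [hpi] at h2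
  refine h2.congr' ?_
  filter_upwards [eventually_gt_atTop 0] with n hn
  have hn' : (0 : ℝ) < n := Nat.cast_pos.2 hn
  have hc : (n.centralBinom : ℝ) = ((2 * n).factorial : ℝ) / (n.factorial : ℝ) ^ 2 := by
    rw [Nat.centralBinom, Nat.cast_choose ℝ (by omega), two_mul, Nat.add_sub_cancel, sq]
  have hs : (n : ℝ) ^ (-1 / 2 : ℝ) = (√n)⁻¹ := by
    rw [neg_div, Real.rpow_neg hn'.le, ← Real.sqrt_eq_rpow]
  have h4 : √(2 * ((2 * n : ℕ) : ℝ)) = 2 * √n := by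
    rw [show 2 * ((2 * n : ℕ) : ℝ) = 2 ^ 2 * n by push_cast; ring, Real.sqrt_mul (by norm_num),
      Real.sqrt_sq (by norm_num)]
  have h5 : √(2 * (n : ℝ)) ^ 2 = 2 * √n ^ 2 := by
    rw [Real.sq_sqrt (by positivity), Real.sq_sqrt hn'.le]
  have h6 : (((2 * n : ℕ) : ℝ) / exp 1) ^ (2 * n) = 4 ^ n * (((n : ℝ) / exp 1) ^ n) ^ 2 := by
    rw [Nat.cast_mul, mul_div_assoc, mul_pow, pow_mul, ← pow_mul _ n 2, mul_comm n 2]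
    norm_num
  simp only [Function.comp, id, Pi.div_apply, Stirling.stirlingSeq]
  rw [hc, hs, h4, h6]
  have h7 : ((n : ℝ) / exp 1) ^ n ≠ 0 := by positivity
  generalize ((n : ℝ) / exp 1) ^ n = e at h7 ⊢
  rw [div_pow, mul_pow, h5]
  have : √(n : ℝ) ≠ 0 := by positivity
  field_simp

namespace PowerSeries

/-- The `n`-th coefficient of `f`, divided by `4 ^ n * n ^ (x / 2 - 1)`. -/
noncomputable def scaledCoeff (f : ℝ⟦X⟧) (x : ℝ) (n : ℕ) : ℝ :=
  coeff n f / (4 ^ n * (n : ℝ) ^ (x / 2 - 1))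

theorem coeff_rsqrt_zpow_add_two (j : ℤ) (hj : j ≠ 0) (n : ℕ) :
    coeff n ((rsqrt ^ (j + 2) : ℝ⟦X⟧ˣ) : ℝ⟦X⟧) =
      (2 * n / j + 1) * coeff n ((rsqrt ^ j : ℝ⟦X⟧ˣ) : ℝ⟦X⟧) := by
  have h := congrArg (coeff n) (euler_rsqrt_zpow j)
  rw [coeff_euler, coeff_smul, map_sub, smul_eq_mul] at h
  have : (j : ℝ) ≠ 0 := Int.cast_ne_zero.2 hj
  field_simp
  linear_combination -2 * h

theorem scaledCoeff_add_two (j : ℤ) (hj : j ≠ 0) {n : ℕ} (hn : 0 < n) :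
    scaledCoeff ((rsqrt ^ (j + 2) : ℝ⟦X⟧ˣ) : ℝ⟦X⟧) (j + 2 : ℤ) n =
      (2 / j + 1 / n) * scaledCoeff ((rsqrt ^ j : ℝ⟦X⟧ˣ) : ℝ⟦X⟧) j n := by
  have hn' : (0 : ℝ) < n := Nat.cast_pos.2 hn
  have : (j : ℝ) ≠ 0 := Int.cast_ne_zero.2 hj
  rw [scaledCoeff, scaledCoeff, coeff_rsqrt_zpow_add_two j hj,
    show (((j + 2 : ℤ) : ℝ) / 2 - 1) = ((j : ℝ) / 2 - 1) + 1 by push_cast; ring,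
    Real.rpow_add_one hn'.ne']
  have : (n : ℝ) ^ ((j : ℝ) / 2 - 1) ≠ 0 := by positivity
  field_simp

theorem tendsto_two_div_add (j : ℤ) :
    Tendsto (fun n : ℕ => (2 / j + 1 / n : ℝ)) atTop (𝓝 (2 / j)) := by
  simpa using tendsto_const_nhds.add (tendsto_one_div_atTop_nhds_zero_nat (𝕜 := ℝ))

/-- The factor `2 / j + 1 / n` between the scaled coefficients tends to `2 / j`, matching `Γ (j / 2
+ 1) = (j / 2) Γ (j / 2)`. As `2 / j ≠ 0`, the step can be reversed, which reaches negative
exponents. -/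
theorem tendsto_scaledCoeff_add_two_iff (j : ℤ) (hj : j ≠ 0) :
    Tendsto (scaledCoeff ((rsqrt ^ (j + 2) : ℝ⟦X⟧ˣ) : ℝ⟦X⟧) (j + 2 : ℤ)) atTop
      (𝓝 (Gamma ((j + 2 : ℤ) / 2))⁻¹) ↔
    Tendsto (scaledCoeff ((rsqrt ^ j : ℝ⟦X⟧ˣ) : ℝ⟦X⟧) j) atTop (𝓝 (Gamma (j / 2))⁻¹) := by
  have hj' : (j : ℝ) ≠ 0 := Int.cast_ne_zero.2 hj
  have hG : (Gamma ((j + 2 : ℤ) / 2))⁻¹ = 2 / j * (Gamma ((j : ℝ) / 2))⁻¹ := by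
    rw [show ((j + 2 : ℤ) : ℝ) / 2 = (j : ℝ) / 2 + 1 by push_cast; ring,
      Real.Gamma_add_one (by positivity), mul_inv, inv_div]
  have h2 : (2 / j : ℝ) ≠ 0 := by positivity
  have ht := tendsto_two_div_add j
  constructor
  · intro h
    have h3 := h.div ht h2
    rw [hG, mul_div_cancel_left₀ _ h2] at h3
    refine h3.congr' ?_
    filter_upwards [eventually_gt_atTop 0, ht.eventually_ne h2] with n hn hne
    rw [Pi.div_apply, scaledCoeff_add_two j hj hn, mul_div_cancel_left₀ _ hne]
  · intro h
    rw [hG]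
    refine (ht.mul h).congr' ?_
    filter_upwards [eventually_gt_atTop 0] with n hn
    rw [scaledCoeff_add_two j hj hn]

theorem coeff_rsqrt_sq (n : ℕ) : coeff n ((rsqrt ^ (2 : ℤ) : ℝ⟦X⟧ˣ) : ℝ⟦X⟧) = 4 ^ n := by
  set f := ((rsqrt ^ (2 : ℤ) : ℝ⟦X⟧ˣ) : ℝ⟦X⟧) with hf
  have h : f = 1 + (4 : ℝ) • (X * f) := by
    have h1 : f * ((rsqrt⁻¹ : ℝ⟦X⟧ˣ) : ℝ⟦X⟧) ^ 2 = 1 := by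
      rw [hf, ← Units.val_pow_eq_pow_val, ← Units.val_mul]
      simp [zpow_ofNat]
    rw [rsqrt_inv_sq] at h1
    rw [smul_eq_C_mul, map_ofNat]
    linear_combination h1
  induction n with
  | zero => rw [h]; simp
  | succ n ih =>
    rw [h, map_add, coeff_smul, coeff_succ_X_mul, ih]
    simp [coeff_one, pow_succ, mul_comm]

theorem coeff_succ_sizeSumSeries_zero (n : ℕ) :
    coeff (n + 1) (sizeSumSeries 0) = (n.centralBinom : ℝ) / (n + 1) := by
  rw [coeff_succ_sizeSumSeries]
  simp only [pow_zero, Finset.sum_const, nsmul_eq_mul, mul_one,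
    BinaryTree.treesOfNumNodesEq_card_eq_catalan]
  rw [eq_div_iff (by positivity), ← succ_mul_catalan_eq_centralBinom]
  push_cast
  ring

theorem coeff_rsqrt_inv {n : ℕ} (hn : 0 < n) :
    coeff n ((rsqrt ^ (-1 : ℤ) : ℝ⟦X⟧ˣ) : ℝ⟦X⟧) = -2 * coeff n (sizeSumSeries 0) := by
  have h := congrArg (coeff n) two_smul_sizeSumSeries_zero
  rw [coeff_smul, map_sub, coeff_one, if_neg hn.ne', smul_eq_mul] at h
  linear_combination h

theorem coeff_rsqrt {n : ℕ} (hn : 0 < n) :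
    coeff n ((rsqrt ^ (1 : ℤ) : ℝ⟦X⟧ˣ) : ℝ⟦X⟧) = n.centralBinom := by
  have h := coeff_rsqrt_zpow_add_two (-1) (by norm_num) n
  obtain ⟨n, rfl⟩ := Nat.exists_eq_add_of_le' hn
  rw [coeff_rsqrt_inv hn, coeff_succ_sizeSumSeries_zero] at h
  norm_num at h
  have h1 := congrArg (Nat.cast (R := ℝ)) (Nat.succ_mul_centralBinom_succ n)
  push_cast at h1
  rw [zpow_one, h]
  field_simp
  linear_combination -h1

theorem tendsto_scaledCoeff_one :
    Tendsto (scaledCoeff ((rsqrt ^ (1 : ℤ) : ℝ⟦X⟧ˣ) : ℝ⟦X⟧) (1 : ℤ)) atTop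
      (𝓝 (Gamma ((1 : ℤ) / 2))⁻¹) := by
  rw [Int.cast_one, Real.Gamma_one_half_eq]
  refine tendsto_centralBinom_div.congr' ?_
  filter_upwards [eventually_gt_atTop 0] with n hn
  rw [scaledCoeff, coeff_rsqrt hn]
  norm_num

theorem tendsto_scaledCoeff_two :
    Tendsto (scaledCoeff ((rsqrt ^ (2 : ℤ) : ℝ⟦X⟧ˣ) : ℝ⟦X⟧) (2 : ℤ)) atTop
      (𝓝 (Gamma ((2 : ℤ) / 2))⁻¹) := by
  refine tendsto_const_nhds.congr fun n => ?_
  rw [scaledCoeff, coeff_rsqrt_sq]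
  simp

/-- `rsqrt ^ 0 = 1` has no coefficients beyond the constant one, and `Gamma 0 = 0` by convention,
with inverse `0`. The steps by 2 exclude `j = 0`, so this is a separate base for the nonpositive
even exponents. -/
theorem tendsto_scaledCoeff_zero :
    Tendsto (scaledCoeff ((rsqrt ^ (0 : ℤ) : ℝ⟦X⟧ˣ) : ℝ⟦X⟧) (0 : ℤ)) atTop
      (𝓝 (Gamma ((0 : ℤ) / 2))⁻¹) := by
  refine tendsto_const_nhds.congr' ?_
  filter_upwards [eventually_gt_atTop 0] with n hn
  simp [scaledCoeff, coeff_one, hn.ne', Real.Gamma_zero]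

theorem tendsto_scaledCoeff_zpow (j : ℤ) :
    Tendsto (scaledCoeff ((rsqrt ^ j : ℝ⟦X⟧ˣ) : ℝ⟦X⟧) j) atTop (𝓝 (Gamma (j / 2))⁻¹) := by
  have up : ∀ k : ℕ, Tendsto (scaledCoeff ((rsqrt ^ ((k : ℤ) + 1) : ℝ⟦X⟧ˣ) : ℝ⟦X⟧)
      ((k : ℤ) + 1 : ℤ)) atTop (𝓝 (Gamma (((k : ℤ) + 1 : ℤ) / 2))⁻¹) := by
    intro k
    induction k using Nat.twoStepInduction with
    | zero => exact tendsto_scaledCoeff_one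
    | one => exact tendsto_scaledCoeff_two
    | more k h _ =>
      have := (tendsto_scaledCoeff_add_two_iff ((k : ℤ) + 1) (by omega)).2 h
      rwa [show (k : ℤ) + 1 + 2 = ((k + 2 : ℕ) : ℤ) + 1 by push_cast; ring] at this
  have down : ∀ k : ℕ, Tendsto (scaledCoeff ((rsqrt ^ (-(k : ℤ)) : ℝ⟦X⟧ˣ) : ℝ⟦X⟧)
      (-(k : ℤ) : ℤ)) atTop (𝓝 (Gamma ((-(k : ℤ) : ℤ) / 2))⁻¹) := by
    intro k
    induction k using Nat.twoStepInduction with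
    | zero => exact tendsto_scaledCoeff_zero
    | one => exact (tendsto_scaledCoeff_add_two_iff (-1) (by omega)).1 tendsto_scaledCoeff_one
    | more k h _ =>
      refine (tendsto_scaledCoeff_add_two_iff (-((k + 2 : ℕ) : ℤ)) (by omega)).1 ?_
      rwa [show -((k + 2 : ℕ) : ℤ) + 2 = -(k : ℤ) by push_cast; ring]
  rcases lt_or_ge 0 j with hj | hj
  · obtain ⟨k, rfl⟩ : ∃ k : ℕ, j = (k : ℤ) + 1 := ⟨(j - 1).toNat, by omega⟩
    exact up k
  · obtain ⟨k, rfl⟩ : ∃ k : ℕ, j = -(k : ℤ) := ⟨(-j).toNat, by omega⟩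
    exact down k

theorem tendsto_scaledCoeff_of_mem {a : ℤ} {f : ℝ⟦X⟧} (hf : f ∈ rsqrtSpan a) {x : ℝ}
    (hx : (a : ℝ) < x) : Tendsto (scaledCoeff f x) atTop (𝓝 0) := by
  rw [rsqrtSpan] at hf
  induction hf using Submodule.span_induction with
  | mem f hf =>
    obtain ⟨j, hj, rfl⟩ := hf
    have hjx : 0 < (x - j) / 2 := by
      have : (j : ℝ) ≤ a := Int.cast_le.2 hj
      linarith
    have h := (tendsto_scaledCoeff_zpow j).mul
      ((tendsto_rpow_neg_atTop hjx).comp tendsto_natCast_atTop_atTop)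
    rw [mul_zero] at h
    refine h.congr' ?_
    filter_upwards [eventually_gt_atTop 0] with n hn
    have hn' : (0 : ℝ) < n := Nat.cast_pos.2 hn
    rw [Function.comp_apply, scaledCoeff, scaledCoeff, Real.rpow_neg hn'.le, ← div_eq_mul_inv,
      div_div, mul_assoc, ← Real.rpow_add hn']
    congr 3
    ring
  | zero =>
    refine (tendsto_const_nhds (x := (0 : ℝ))).congr fun n => ?_
    simp [scaledCoeff]
  | add f g _ _ hf hg =>
    refine (add_zero (0 : ℝ) ▸ hf.add hg).congr fun n => ?_
    simp [scaledCoeff, add_div]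
  | smul c f _ hf =>
    refine (mul_zero c ▸ hf.const_mul c).congr fun n => ?_
    simp [scaledCoeff, mul_div_assoc]

theorem HasLeading.tendsto_scaledCoeff {f : ℝ⟦X⟧} {c : ℝ} {d : ℤ} (h : HasLeading f c d) :
    Tendsto (scaledCoeff f d) atTop (𝓝 (c * (Gamma (d / 2))⁻¹)) := by
  have h1 := tendsto_scaledCoeff_of_mem h (x := d) (by push_cast; linarith)
  have h2 := h1.add ((tendsto_scaledCoeff_zpow d).const_mul c)
  rw [zero_add] at h2
  refine h2.congr fun n => ?_
  simp [scaledCoeff, sub_div, mul_div_assoc]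

/-- The degree-0 term of `F 0` is a constant, invisible to large coefficients; the asymptotics come
from `-1/2 * rsqrt⁻¹` and `Γ (-1/2) = -2 √π`. -/
theorem tendsto_scaledCoeff_sizeSumSeries_zero :
    Tendsto (scaledCoeff (sizeSumSeries 0) (-1)) atTop (𝓝 (4 * √π)⁻¹) := by
  have h := (tendsto_scaledCoeff_zpow (-1)).const_mul (-1 / 2)
  have hG : -1 / 2 * (Gamma ((-1 : ℤ) / 2))⁻¹ = (4 * √π)⁻¹ := by
    have h1 := Real.Gamma_add_one (s := ((-1 : ℤ) : ℝ) / 2) (by norm_num)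
    rw [show ((-1 : ℤ) : ℝ) / 2 + 1 = 1 / 2 by norm_num, Real.Gamma_one_half_eq] at h1
    rw [h1]
    push_cast
    rw [mul_inv, mul_inv]
    norm_num [← mul_assoc]
  rw [hG] at h
  refine h.congr' ?_
  filter_upwards [eventually_gt_atTop 0] with n hn
  rw [scaledCoeff, scaledCoeff, coeff_rsqrt_inv hn]
  push_cast
  ring

end PowerSeries

/-! ### Convergence of moments -/

open PowerSeries BinaryTree

/-- The limits of the moments of `sizeSum` divided by the power `3 / 2` of the size. -/
noncomputable def limitMoment : ℕ → ℝ
  | 0 => 1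
  | k + 1 => 4 * √π * leadingConst k / Gamma ((3 * k + 2) / 2)

theorem tendsto_moment (k : ℕ) :
    Tendsto (fun m : ℕ => uniformMean (treesOfNumNodesEq m)
      (fun t => (((m + 1 : ℕ) : ℝ) ^ (-3 / 2 : ℝ) * t.sizeSum) ^ k)) atTop
      (𝓝 (limitMoment k)) := by
  rcases k with _ | k
  · refine tendsto_const_nhds.congr fun m => ?_
    have := (treesOfNumNodesEq_nonempty m).card_ne_zero
    simp [uniformMean, limitMoment, this]
  · have h := ((hasLeading_sizeSumSeries_succ k).tendsto_scaledCoeff.div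
      tendsto_scaledCoeff_sizeSumSeries_zero (by positivity)).comp (tendsto_add_atTop_nat 1)
    have hl : leadingConst k * (Gamma (((3 * k + 2 : ℤ) : ℝ) / 2))⁻¹ / (4 * √π)⁻¹ =
        limitMoment (k + 1) := by
      rw [limitMoment, div_inv_eq_mul]
      push_cast
      ring
    rw [hl] at h
    refine h.congr fun m => ?_
    have hm : (0 : ℝ) < ((m + 1 : ℕ) : ℝ) := by positivity
    simp only [Function.comp_apply, Pi.div_apply, scaledCoeff, coeff_succ_sizeSumSeries,
      uniformMean, mul_pow, ← Finset.mul_sum, pow_zero, Finset.sum_const, nsmul_eq_mul, mul_one]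
    -- The exponents of the numerator and of the tree count differ by `(3 k + 2) / 2 + 1 / 2 = 3 (k
    -- + 1) / 2`.
    have h1 : (((m + 1 : ℕ) : ℝ) ^ (-3 / 2 : ℝ)) ^ (k + 1) =
        ((m + 1 : ℕ) : ℝ) ^ ((-1 : ℝ) / 2 - 1) /
          ((m + 1 : ℕ) : ℝ) ^ (((3 * k + 2 : ℤ) : ℝ) / 2 - 1) := by
      rw [← Real.rpow_sub hm, ← Real.rpow_natCast, ← Real.rpow_mul hm.le]
      congr 1
      push_cast
      ring
    rw [h1]
    have : ((m + 1 : ℕ) : ℝ) ^ ((-1 : ℝ) / 2 - 1) ≠ 0 := by positivity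
    have : ((m + 1 : ℕ) : ℝ) ^ (((3 * k + 2 : ℤ) : ℝ) / 2 - 1) ≠ 0 := by positivity
    have : ((treesOfNumNodesEq m).card : ℝ) ≠ 0 :=
      Nat.cast_ne_zero.2 (treesOfNumNodesEq_nonempty m).card_ne_zero
    field_simp

/-- The limits of the central moments of `sizeSum` divided by the power `3 / 2` of the size. -/
noncomputable def limitCentralMoment (i : ℕ) : ℝ :=
  ∑ k ∈ Finset.range (i + 1), limitMoment k * (-limitMoment 1) ^ (i - k) * (i.choose k : ℝ)

theorem tendsto_centralMoment (i : ℕ) :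
    Tendsto (fun m : ℕ => centralMomentOn (treesOfNumNodesEq m)
      (fun t => ((m + 1 : ℕ) : ℝ) ^ (-3 / 2 : ℝ) * t.sizeSum) i) atTop
      (𝓝 (limitCentralMoment i)) := by
  simp only [centralMomentOn_eq_sum]
  refine tendsto_finsetSum _ fun k _ => ((tendsto_moment k).mul (Tendsto.pow ?_ _)).mul_const _
  simpa using (tendsto_moment 1).neg

theorem tendsto_binaryHeightScaledMoment (i : ℕ) (h2 : 0 < limitCentralMoment 2) :
    Tendsto (fun m : ℕ => binaryHeightScaledMoment i (2 * m + 1)) atTop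
      (𝓝 (limitCentralMoment i / limitCentralMoment 2 ^ ((i : ℝ) / 2))) := by
  have h := (tendsto_centralMoment i).div
    ((tendsto_centralMoment 2).rpow_const (p := (i : ℝ) / 2) (Or.inl h2.ne'))
    (Real.rpow_pos_of_pos h2 _).ne'
  refine h.congr fun m => ?_
  rw [binaryHeightScaledMoment_eq i m (c := ((m + 1 : ℕ) : ℝ) ^ (-3 / 2 : ℝ)) (by positivity)]
  rfl

/-! ### Explicit constants and limit moments -/

theorem leadingConst_succ (k : ℕ) : leadingConst (k + 1) =
    ∑ b ∈ Finset.range (k + 1),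
      ((k + 2).choose (b + 1) : ℝ) * (leadingConst b * leadingConst (k - b)) +
        (k + 2) * ((3 * k + 2) / 2 * leadingConst k) := by
  rw [leadingConst, Finset.sum_range]

theorem leadingConst_zero : leadingConst 0 = 1 / 4 := by
  rw [leadingConst]

theorem leadingConst_one : leadingConst 1 = 5/8 := by
  rw [leadingConst_succ]
  norm_num [Finset.sum_range_succ, Nat.choose_succ_succ,
    leadingConst_zero]

theorem leadingConst_two : leadingConst 2 = 45/8 := by
  rw [leadingConst_succ]
  norm_num [Finset.sum_range_succ, Nat.choose_succ_succ,
    leadingConst_zero, leadingConst_one]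

theorem leadingConst_three : leadingConst 3 = 3315/32 := by
  rw [leadingConst_succ]
  norm_num [Finset.sum_range_succ, Nat.choose_succ_succ,
    leadingConst_zero, leadingConst_one, leadingConst_two]

theorem leadingConst_four : leadingConst 4 = 25425/8 := by
  rw [leadingConst_succ]
  norm_num [Finset.sum_range_succ, Nat.choose_succ_succ,
    leadingConst_zero, leadingConst_one, leadingConst_two,
    leadingConst_three]

theorem leadingConst_five : leadingConst 5 = 18635625/128 := by
  rw [leadingConst_succ]
  norm_num [Finset.sum_range_succ, Nat.choose_succ_succ,
    leadingConst_zero, leadingConst_one, leadingConst_two,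
    leadingConst_three, leadingConst_four]

theorem leadingConst_six : leadingConst 6 = 18592875/2 := by
  rw [leadingConst_succ]
  norm_num [Finset.sum_range_succ, Nat.choose_succ_succ,
    leadingConst_zero, leadingConst_one, leadingConst_two,
    leadingConst_three, leadingConst_four, leadingConst_five]

theorem leadingConst_seven : leadingConst 7 = 403839930375/512 := by
  rw [leadingConst_succ]
  norm_num [Finset.sum_range_succ, Nat.choose_succ_succ,
    leadingConst_zero, leadingConst_one, leadingConst_two,
    leadingConst_three, leadingConst_four, leadingConst_five,
    leadingConst_six]

theorem leadingConst_eight : leadingConst 8 = 686591002125/8 := by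
  rw [leadingConst_succ]
  norm_num [Finset.sum_range_succ, Nat.choose_succ_succ,
    leadingConst_zero, leadingConst_one, leadingConst_two,
    leadingConst_three, leadingConst_four, leadingConst_five,
    leadingConst_six, leadingConst_seven]

theorem limitMoment_zero : limitMoment 0 = 1 := rfl

/-- The argument of `Gamma` is an integer for odd moments, which keep the factor `√π`, and a
half-integer for even ones, where `√π` cancels. -/
theorem limitMoment_one : limitMoment 1 = √π := by
  rw [limitMoment, leadingConst_zero,
    show (3 * ((0 : ℕ) : ℝ) + 2) / 2 = ((0 : ℕ) : ℝ) + 1 by norm_num,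
    Real.Gamma_nat_eq_factorial]
  norm_num [Nat.factorial]
  ring

theorem limitMoment_two : limitMoment 2 = 10 / 3 := by
  rw [limitMoment, leadingConst_one,
    show (3 * ((1 : ℕ) : ℝ) + 2) / 2 = ((2 : ℕ) : ℝ) + 1 / 2 by norm_num,
    Real.Gamma_nat_add_half]
  have : √π ≠ 0 := by positivity
  norm_num [Nat.doubleFactorial]
  field_simp
  norm_num

theorem limitMoment_three : limitMoment 3 = 15 / 4 * √π := by
  rw [limitMoment, leadingConst_two,
    show (3 * ((2 : ℕ) : ℝ) + 2) / 2 = ((3 : ℕ) : ℝ) + 1 by norm_num,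
    Real.Gamma_nat_eq_factorial]
  norm_num [Nat.factorial]
  ring

theorem limitMoment_four : limitMoment 4 = 884 / 63 := by
  rw [limitMoment, leadingConst_three,
    show (3 * ((3 : ℕ) : ℝ) + 2) / 2 = ((5 : ℕ) : ℝ) + 1 / 2 by norm_num,
    Real.Gamma_nat_add_half]
  have : √π ≠ 0 := by positivity
  norm_num [Nat.doubleFactorial]
  field_simp
  norm_num

theorem limitMoment_five : limitMoment 5 = 565 / 32 * √π := by
  rw [limitMoment, leadingConst_four,
    show (3 * ((4 : ℕ) : ℝ) + 2) / 2 = ((6 : ℕ) : ℝ) + 1 by norm_num,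
    Real.Gamma_nat_eq_factorial]
  norm_num [Nat.factorial]
  ring

theorem limitMoment_six : limitMoment 6 = 662600 / 9009 := by
  rw [limitMoment, leadingConst_five,
    show (3 * ((5 : ℕ) : ℝ) + 2) / 2 = ((8 : ℕ) : ℝ) + 1 / 2 by norm_num,
    Real.Gamma_nat_add_half]
  have : √π ≠ 0 := by positivity
  norm_num [Nat.doubleFactorial]
  field_simp
  norm_num

theorem limitMoment_seven : limitMoment 7 = 19675 / 192 * √π := by
  rw [limitMoment, leadingConst_six,
    show (3 * ((6 : ℕ) : ℝ) + 2) / 2 = ((9 : ℕ) : ℝ) + 1 by norm_num,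
    Real.Gamma_nat_eq_factorial]
  norm_num [Nat.factorial]
  ring

theorem limitMoment_eight : limitMoment 8 = 4102500880 / 8729721 := by
  rw [limitMoment, leadingConst_seven,
    show (3 * ((7 : ℕ) : ℝ) + 2) / 2 = ((11 : ℕ) : ℝ) + 1 / 2 by norm_num,
    Real.Gamma_nat_add_half]
  have : √π ≠ 0 := by positivity
  norm_num [Nat.doubleFactorial]
  field_simp
  norm_num

theorem limitMoment_nine : limitMoment 9 = 16145585 / 22528 * √π := by
  rw [limitMoment, leadingConst_eight,
    show (3 * ((8 : ℕ) : ℝ) + 2) / 2 = ((12 : ℕ) : ℝ) + 1 by norm_num,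
    Real.Gamma_nat_eq_factorial]
  norm_num [Nat.factorial]
  ring

/-! ### Explicit limit central moments and the conclusion -/

theorem limitCentralMoment_two : limitCentralMoment 2 = (10 - 3 * π) / 3 := by
  have h : √π ^ 2 = π := Real.sq_sqrt pi_pos.le
  simp [limitCentralMoment, Finset.sum_range_succ, limitMoment_zero, limitMoment_one, limitMoment_two]
  linear_combination -h

theorem ten_sub_three_mul_pi_pos : 0 < 10 - 3 * π := by
  linarith [pi_lt_d2]

theorem tendsto_binaryHeightScaledMoment_even (j : ℕ) :
    Tendsto (fun m : ℕ => binaryHeightScaledMoment (2 * j) (2 * m + 1)) atTop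
      (𝓝 (limitCentralMoment (2 * j) * 3 ^ j / (10 - 3 * π) ^ j)) := by
  have hd := ten_sub_three_mul_pi_pos
  have h := tendsto_binaryHeightScaledMoment (2 * j) (by rw [limitCentralMoment_two]; positivity)
  convert h using 2
  rw [limitCentralMoment_two, Nat.cast_mul, Nat.cast_two, mul_div_cancel_left₀ _ two_ne_zero,
    Real.rpow_natCast, div_pow, div_div_eq_mul_div]

theorem tendsto_binaryHeightScaledMoment_odd (j : ℕ) {c : ℝ}
    (hc : limitCentralMoment (2 * j + 1) = √π * c) :
    Tendsto (fun m : ℕ => binaryHeightScaledMoment (2 * j + 1) (2 * m + 1)) atTop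
      (𝓝 (3 ^ j * c * √3 * √(π / (10 - 3 * π)) / (10 - 3 * π) ^ j)) := by
  have hd := ten_sub_three_mul_pi_pos
  have h := tendsto_binaryHeightScaledMoment (2 * j + 1)
    (by rw [limitCentralMoment_two]; positivity)
  convert h using 2
  have he : ((2 * j + 1 : ℕ) : ℝ) / 2 = j + 1 / 2 := by push_cast; ring
  rw [limitCentralMoment_two, he, Real.rpow_add (by positivity), Real.rpow_natCast,
    ← Real.sqrt_eq_rpow, div_pow, hc, Real.sqrt_div pi_pos.le, Real.sqrt_div hd.le]
  have : √(10 - 3 * π) ≠ 0 := by positivity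
  field_simp

theorem limitCentralMoment_three : limitCentralMoment 3 =
    √π * ((6 * π - 75 / 4) / 3) := by
  have h : π = √π ^ 2 := (Real.sq_sqrt pi_pos.le).symm
  norm_num [limitCentralMoment, Finset.sum_range_succ, Nat.choose_succ_succ, limitMoment_zero,
    limitMoment_one, limitMoment_two, limitMoment_three]
  -- Hiding `√π` first frees `π` to be replaced by `p ^ 2`; a polynomial identity in `p` remains.
  generalize √π = p at h ⊢
  generalize π = q at h ⊢
  subst h
  ring

theorem limitCentralMoment_four : limitCentralMoment 4 =
    (-189 * π ^ 2 + 315 * π + 884) / 63 := by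
  have h : π = √π ^ 2 := (Real.sq_sqrt pi_pos.le).symm
  norm_num [limitCentralMoment, Finset.sum_range_succ, Nat.choose_succ_succ, limitMoment_zero,
    limitMoment_one, limitMoment_two, limitMoment_three, limitMoment_four]
  generalize √π = p at h ⊢
  generalize π = q at h ⊢
  subst h
  ring

theorem limitCentralMoment_five : limitCentralMoment 5 =
    √π * ((36 * π ^ 2 + 75 / 2 * π - 105845 / 224) / 9) := by
  have h : π = √π ^ 2 := (Real.sq_sqrt pi_pos.le).symm
  norm_num [limitCentralMoment, Finset.sum_range_succ, Nat.choose_succ_succ, limitMoment_zero,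
    limitMoment_one, limitMoment_two, limitMoment_three, limitMoment_four, limitMoment_five]
  generalize √π = p at h ⊢
  generalize π = q at h ⊢
  subst h
  ring

theorem limitCentralMoment_six : limitCentralMoment 6 =
    15 / 16016 * (-144144 * π ^ 3 - 720720 * π ^ 2 + 3013725 * π + 2120320) / 27 := by
  have h : π = √π ^ 2 := (Real.sq_sqrt pi_pos.le).symm
  norm_num [limitCentralMoment, Finset.sum_range_succ, Nat.choose_succ_succ, limitMoment_zero,
    limitMoment_one, limitMoment_two, limitMoment_three, limitMoment_four, limitMoment_five,
    limitMoment_six]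
  generalize √π = p at h ⊢
  generalize π = q at h ⊢
  subst h
  ring

theorem limitCentralMoment_seven : limitCentralMoment 7 =
    √π * ((162 * π ^ 3 + 6615 / 4 * π ^ 2 - 103965 / 32 * π - 101897475 / 9152) / 27) := by
  have h : π = √π ^ 2 := (Real.sq_sqrt pi_pos.le).symm
  norm_num [limitCentralMoment, Finset.sum_range_succ, Nat.choose_succ_succ, limitMoment_zero,
    limitMoment_one, limitMoment_two, limitMoment_three, limitMoment_four, limitMoment_five,
    limitMoment_six, limitMoment_seven]
  generalize √π = p at h ⊢
  generalize π = q at h ⊢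
  subst h
  ring

theorem limitCentralMoment_eight : limitCentralMoment 8 =
    3 / 2586584 * (-488864376 * π ^ 4 - 8147739600 * π ^ 3 - 455885430 * π ^ 2
      + 86568885375 * π + 32820007040) / 81 := by
  have h : π = √π ^ 2 := (Real.sq_sqrt pi_pos.le).symm
  norm_num [limitCentralMoment, Finset.sum_range_succ, Nat.choose_succ_succ, limitMoment_zero,
    limitMoment_one, limitMoment_two, limitMoment_three, limitMoment_four, limitMoment_five,
    limitMoment_six, limitMoment_seven, limitMoment_eight]
  generalize √π = p at h ⊢
  generalize π = q at h ⊢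
  subst h
  ring

theorem limitCentralMoment_nine : limitCentralMoment 9 =
    √π * ((648 * π ^ 4 + 15795 * π ^ 3 + 591867 / 16 * π ^ 2 - 461286225 / 2288 * π
      - 188411947088175 / 662165504) / 81) := by
  have h : π = √π ^ 2 := (Real.sq_sqrt pi_pos.le).symm
  norm_num [limitCentralMoment, Finset.sum_range_succ, Nat.choose_succ_succ, limitMoment_zero,
    limitMoment_one, limitMoment_two, limitMoment_three, limitMoment_four, limitMoment_five,
    limitMoment_six, limitMoment_seven, limitMoment_eight, limitMoment_nine]
  generalize √π = p at h ⊢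
  generalize π = q at h ⊢
  subst h
  ring

theorem mainTheorem1 :
    (∀ n : ℕ, (OrderedTree.family {2} n).Nonempty ↔ Odd n) ∧
    (∀ m : ℕ, 3 ≤ m → 0 < binaryHeightVariance (2 * m + 1)) ∧
    Tendsto (fun m : ℕ => binaryHeightScaledMoment 3 (2 * m + 1)) atTop
      (𝓝 ((6 * π - 75 / 4) * √3 * √(π / (10 - 3 * π)) / (10 - 3 * π))) ∧
    Tendsto (fun m : ℕ => binaryHeightScaledMoment 4 (2 * m + 1)) atTop
      (𝓝 ((-189 * π ^ 2 + 315 * π + 884) / (7 * (10 - 3 * π) ^ 2))) ∧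
    Tendsto (fun m : ℕ => binaryHeightScaledMoment 5 (2 * m + 1)) atTop
      (𝓝 ((36 * π ^ 2 + 75 / 2 * π - 105845 / 224) * √3 * √(π / (10 - 3 * π))
        / (10 - 3 * π) ^ 2)) ∧
    Tendsto (fun m : ℕ => binaryHeightScaledMoment 6 (2 * m + 1)) atTop
      (𝓝 (15 / 16016 * ((-144144 * π ^ 3 - 720720 * π ^ 2 + 3013725 * π + 2120320)
        / (10 - 3 * π) ^ 3))) ∧
    Tendsto (fun m : ℕ => binaryHeightScaledMoment 7 (2 * m + 1)) atTop
      (𝓝 ((162 * π ^ 3 + 6615 / 4 * π ^ 2 - 103965 / 32 * π - 101897475 / 9152)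
        * √3 * √(π / (10 - 3 * π)) / (10 - 3 * π) ^ 3)) ∧
    Tendsto (fun m : ℕ => binaryHeightScaledMoment 8 (2 * m + 1)) atTop
      (𝓝 (3 / 2586584 * ((-488864376 * π ^ 4 - 8147739600 * π ^ 3 - 455885430 * π ^ 2
        + 86568885375 * π + 32820007040) / (10 - 3 * π) ^ 4))) ∧
    Tendsto (fun m : ℕ => binaryHeightScaledMoment 9 (2 * m + 1)) atTop
      (𝓝 ((648 * π ^ 4 + 15795 * π ^ 3 + 591867 / 16 * π ^ 2 - 461286225 / 2288 * π
        - 188411947088175 / 662165504) * √3 * √(π / (10 - 3 * π)) / (10 - 3 * π) ^ 4)) := by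
  refine ⟨BinaryTree.family_nonempty_iff, fun m hm => binaryHeightVariance_pos hm,
    ?_, ?_, ?_, ?_, ?_, ?_, ?_⟩
  · convert tendsto_binaryHeightScaledMoment_odd 1 limitCentralMoment_three using 2
    ring
  · convert tendsto_binaryHeightScaledMoment_even 2 using 2
    rw [limitCentralMoment_four, ← div_div]
    ring
  · convert tendsto_binaryHeightScaledMoment_odd 2 limitCentralMoment_five using 2
    ring
  · convert tendsto_binaryHeightScaledMoment_even 3 using 2
    rw [limitCentralMoment_six]
    ring
  · convert tendsto_binaryHeightScaledMoment_odd 3 limitCentralMoment_seven using 2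
    ring
  · convert tendsto_binaryHeightScaledMoment_even 4 using 2
    rw [limitCentralMoment_eight]
    ring
  · convert tendsto_binaryHeightScaledMoment_odd 4 limitCentralMoment_nine using 2
    ring
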